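/- A finite chain ring is a finite commutative ring $R$ with $1\neq 0$ whose ideals form a chain under inclusion; such a ring is local. Write $q$ for the cardinality of its residue field and define $r\ge 1$ by $|R|=q^r$. Let ${\rm M}_n(R)$ be the ring of $n\times n$ matrices over $R$, and for $A,B,C\subset {\rm M}_n(R)$ put $A+BC=\{a+bc: a\in A,\ b\in B,\ c\in C\}$. Let $n$ be a positive integer. (1) For every $c>0$ there is a constant $c'>0$, depending only on $n$ and $c$, such that for every finite chain ring $R$, with $q$ and $r$ as above, and all subsets $A,B,C\subset {\rm M}_n(R)$: if $$|A||B||C|\ \ge\ c\,q^{3rn^2-\frac{n+1}{2}},\qquad\text{then}\qquad |A+BC|\ \ge\ c'\,q^{rn^2}.$$ (2) The function $x+yz$ is a moderate expander on ${\rm M}_n(R)$ with exponent $\frac{n+1}{6}$. That is, there is a constant $C(n)>0$, depending only on $n$, such that for every finite chain ring $R$, with $q$ and $r$ as above, and every subset $A\subset{\rm M}_n(R)$ with $|A|\ge C(n)\,q^{rn^2-\frac{n+1}{6}}$, one has $$|\{x+yz: x,y,z\in A\}|\ \ge\ C(n)^{-1}q^{rn^2}.$$ -/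

import Mathlib

open scoped Pointwise

universe u

/-- A finite chain ring: a finite commutative ring with `1 ≠ 0` whose ideals form a chain
under inclusion. -/
class IsFiniteChainRing (R : Type u) [CommRing R] : Prop extends Nontrivial R where
  finite : Finite R
  ideal_chain : ∀ I J : Ideal R, I ≤ J ∨ J ≤ I

attribute [instance] IsFiniteChainRing.finite

/-- A finite chain ring is local, so that its residue field is available. -/
instance IsFiniteChainRing.isLocalRing (R : Type u) [CommRing R] [IsFiniteChainRing R] :
    IsLocalRing R := by
  refine IsLocalRing.of_nonunits_add ?_
  have key : ∀ x y : R, Ideal.span {x} ≤ Ideal.span {y} → y ∈ nonunits R →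
      x + y ∈ nonunits R := by
    intro x y hxy hy hu
    have hdvd : y ∣ x := Ideal.span_singleton_le_span_singleton.mp hxy
    exact hy (isUnit_of_dvd_unit (dvd_add hdvd dvd_rfl) hu)
  intro a b ha hb
  rcases IsFiniteChainRing.ideal_chain (Ideal.span {a}) (Ideal.span {b}) with h | h
  · exact key a b h hb
  · rw [add_comm]
    exact key b a h ha

/-- `R` has residue field of cardinality `q`, and `R` itself has cardinality `q ^ r`. -/
structure HasChainParameters (R : Type u) [CommRing R] [IsFiniteChainRing R] (q r : ℕ) :
    Prop where
  card_residueField : Nat.card (IsLocalRing.ResidueField R) = q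
  card_ring : Nat.card R = q ^ r

/-- The `d`-variable function `f : M_n(R)^d → M_n(R)`, given for all rings `R` at once, is a
moderate expander on `M_n(R)` with exponent `κ`. The constant `C` is the same for all finite
chain rings `R` (hence for all `q` and `r`) and all subsets `A`; it may depend on `n`. -/
def IsModerateExpander (n d : ℕ)
    (f : ∀ (R : Type u) [CommRing R],
      (Fin d → Matrix (Fin n) (Fin n) R) → Matrix (Fin n) (Fin n) R)
    (κ : ℝ) : Prop :=
  0 < κ ∧ ∃ C : ℝ, 0 < C ∧
    ∀ (R : Type u) [CommRing R] [IsFiniteChainRing R] (q r : ℕ), HasChainParameters R q r →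
      ∀ A : Set (Matrix (Fin n) (Fin n) R),
        C * (q : ℝ) ^ ((r : ℝ) * (n : ℝ) ^ 2 - κ) ≤ (A.ncard : ℝ) →
          C⁻¹ * (q : ℝ) ^ (r * n ^ 2) ≤
            ((f R '' {v | ∀ i, v i ∈ A}).ncard : ℝ)

/-!
Write `M = M_n(R)` and `N = |M|`. The number of representations of `t` as `a + b * c` with
`a ∈ A`, `b ∈ B`, `c ∈ C` is analysed by its Fourier transform on the additive group of `M`, which
at a character `ψ` equals `(∑ a ∈ A, ψ a) * (∑ b ∈ B, ∑ c ∈ C, ψ (b * c))`.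

For `ψ ≠ 0` the second factor is a bilinear sum. By Cauchy–Schwarz and orthogonality its square is
at most `|B| |C| N |I|` (`sq_norm_sum_sum_addChar_mul_le`), where `I` is the right ideal of all
`x` with `ψ (x * c) = 1` for every `c`. It is a proper right ideal, because it contains `1` only
if `ψ` is trivial. Over a local ring with residue field of size `q`, a proper right ideal of the
matrix ring has index at least `q ^ n` (`Matrix.card_residueField_pow_le_index`): it misses some
`E_ii`, and then row vectors placed in row `i` that differ modulo the maximal ideal lie in
different cosets. Hence `|I| ≤ N / q ^ n`.

Parseval for the representation function and for the indicator of `A` turns this into a second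
moment bound (`card_mul_sum_sq_repCount_le`), and one more Cauchy–Schwarz gives a lower bound for
`|A + B * C|` (`card_mul_le_of_mul_le`). It needs only `|A| |B| |C| ≥ c N ^ 3 / q ^ n`, which the
hypothesis implies since `(n + 1) / 2 ≤ n`.
-/

open Finset ComplexConjugate

/-! ### Parseval's identity on a finite abelian group -/

theorem AddChar.sum_sq_norm_sum_mul {G : Type*} [AddCommGroup G] [Fintype G] (f : G → ℂ) :
    ∑ ψ : AddChar G ℂ, ‖∑ x, f x * ψ x‖ ^ 2 = Fintype.card G * ∑ x, ‖f x‖ ^ 2 := by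
  classical
  have h : ∀ ψ : AddChar G ℂ, ((‖∑ x, f x * ψ x‖ ^ 2 : ℝ) : ℂ)
      = ∑ x, ∑ y, f x * conj (f y) * ψ (x - y) := by
    intro ψ
    rw [Complex.ofReal_pow, ← Complex.mul_conj', map_sum, Finset.sum_mul_sum]
    refine Finset.sum_congr rfl fun x _ => Finset.sum_congr rfl fun y _ => ?_
    rw [map_mul, sub_eq_add_neg, AddChar.map_add_eq_mul, AddChar.map_neg_eq_conj]
    ring
  apply Complex.ofReal_injective
  rw [Complex.ofReal_sum, Finset.sum_congr rfl fun ψ _ => h ψ, Finset.sum_comm]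
  push_cast
  rw [Finset.mul_sum]
  refine Finset.sum_congr rfl fun x _ => ?_
  rw [Finset.sum_comm]
  simp_rw [← Finset.mul_sum, AddChar.sum_apply_eq_ite, sub_eq_zero]
  rw [← Complex.mul_conj']
  simp [mul_comm]

theorem AddChar.sum_sq_norm_sum {G : Type*} [AddCommGroup G] [Fintype G] (A : Finset G) :
    ∑ ψ : AddChar G ℂ, ‖∑ a ∈ A, ψ a‖ ^ 2 = Fintype.card G * (#A : ℝ) := by
  classical
  simpa [apply_ite, ite_mul, ite_pow] using
    AddChar.sum_sq_norm_sum_mul (fun x : G => if x ∈ A then (1 : ℂ) else 0)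

/-! ### Bilinear character sums over a finite ring -/

section FiniteRing

variable {M : Type*} [Ring M] [Fintype M]

/-- The additive subgroup of all `x` with `ψ (x * c) = 1` for every `c`: the largest right ideal
of `M` on which `ψ` is trivial. -/
def AddChar.rightKernel (ψ : AddChar M ℂ) : AddSubgroup M where
  carrier := {x | ∀ c, ψ (x * c) = 1}
  zero_mem' := by simp
  add_mem' := by
    intro x y hx hy c
    rw [add_mul, AddChar.map_add_eq_mul, hx, hy, one_mul]
  neg_mem' := by
    intro x hx c
    rw [← mul_neg_one, mul_assoc]
    exact hx _

omit [Fintype M] in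
theorem AddChar.mem_rightKernel {ψ : AddChar M ℂ} {x : M} :
    x ∈ ψ.rightKernel ↔ ∀ c, ψ (x * c) = 1 := Iff.rfl

theorem AddChar.sum_mul_left_eq_ite (ψ : AddChar M ℂ) (x : M) [Decidable (x ∈ ψ.rightKernel)] :
    ∑ c, ψ (x * c) = if x ∈ ψ.rightKernel then (Fintype.card M : ℂ) else 0 := by
  classical
  have h := AddChar.sum_eq_ite (ψ.compAddMonoidHom (AddMonoidHom.mulLeft x))
  simpa [AddChar.eq_zero_iff, AddChar.mem_rightKernel] using h

theorem sq_norm_sum_sum_addChar_mul_le (ψ : AddChar M ℂ) (B C : Finset M) :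
    ‖∑ b ∈ B, ∑ c ∈ C, ψ (b * c)‖ ^ 2
      ≤ #B * #C * Fintype.card M * Nat.card ψ.rightKernel := by
  classical
  have hexp : ∑ c : M, ‖∑ b ∈ B, ψ (b * c)‖ ^ 2
      = ∑ b ∈ B, ∑ b' ∈ B, if b - b' ∈ ψ.rightKernel then (Fintype.card M : ℝ) else 0 := by
    apply Complex.ofReal_injective
    have h : ∀ c : M, ((‖∑ b ∈ B, ψ (b * c)‖ ^ 2 : ℝ) : ℂ)
        = ∑ b ∈ B, ∑ b' ∈ B, ψ ((b - b') * c) := by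
      intro c
      rw [Complex.ofReal_pow, ← Complex.mul_conj', map_sum, Finset.sum_mul_sum]
      refine Finset.sum_congr rfl fun x _ => Finset.sum_congr rfl fun y _ => ?_
      rw [sub_mul, sub_eq_add_neg, AddChar.map_add_eq_mul, AddChar.map_neg_eq_conj]
    rw [Complex.ofReal_sum, Finset.sum_congr rfl fun c _ => h c, Finset.sum_comm]
    push_cast
    refine Finset.sum_congr rfl fun b _ => ?_
    rw [Finset.sum_comm]
    refine Finset.sum_congr rfl fun b' _ => ?_
    rw [AddChar.sum_mul_left_eq_ite]
    split_ifs <;> simp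
  -- For fixed `b`, the `b'` with `b - b'` in the subgroup are at most as many as its elements.
  have hrow : ∀ b, ∑ b' ∈ B, (if b - b' ∈ ψ.rightKernel then (Fintype.card M : ℝ) else 0)
      ≤ Fintype.card M * Nat.card ψ.rightKernel := by
    intro b
    rw [← Finset.sum_filter, Finset.sum_const, nsmul_eq_mul, mul_comm]
    gcongr
    rw [Nat.card_eq_fintype_card, ← Fintype.card_coe]
    refine Fintype.card_le_of_injective
      (fun b' => ⟨b - b'.1, (Finset.mem_filter.1 b'.2).2⟩) fun x y h => ?_
    exact Subtype.ext (sub_right_injective (congrArg Subtype.val h))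
  calc ‖∑ b ∈ B, ∑ c ∈ C, ψ (b * c)‖ ^ 2
      ≤ (∑ c ∈ C, ‖∑ b ∈ B, ψ (b * c)‖) ^ 2 := by
        rw [Finset.sum_comm]
        gcongr
        exact norm_sum_le _ _
    _ ≤ #C * ∑ c ∈ C, ‖∑ b ∈ B, ψ (b * c)‖ ^ 2 := sq_sum_le_card_mul_sum_sq
    _ ≤ #C * ∑ c : M, ‖∑ b ∈ B, ψ (b * c)‖ ^ 2 := by
        gcongr
        exact Finset.subset_univ _
    _ ≤ #C * ∑ b ∈ B, (Fintype.card M * Nat.card ψ.rightKernel : ℝ) := by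
        rw [hexp]
        gcongr with b
        exact hrow b
    _ = #B * #C * Fintype.card M * Nat.card ψ.rightKernel := by
        rw [Finset.sum_const, nsmul_eq_mul]
        ring

/-! ### The second moment of the representation function of `A + B * C` -/

/-- The number of representations of `t` as `a + b * c` with `a ∈ A`, `b ∈ B`, `c ∈ C`. -/
noncomputable def repCount (A B C : Finset M) (t : M) : ℕ :=
  open Classical in #{p ∈ A ×ˢ B ×ˢ C | p.1 + p.2.1 * p.2.2 = t}

theorem sum_repCount_mul (A B C : Finset M) (ψ : AddChar M ℂ) :
    ∑ t, (repCount A B C t : ℂ) * ψ t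
      = (∑ a ∈ A, ψ a) * ∑ b ∈ B, ∑ c ∈ C, ψ (b * c) := by
  classical
  have h : ∀ t, (repCount A B C t : ℂ) * ψ t
      = ∑ p ∈ A ×ˢ B ×ˢ C with p.1 + p.2.1 * p.2.2 = t, ψ (p.1 + p.2.1 * p.2.2) := by
    intro t
    rw [Finset.sum_congr rfl fun p hp => by rw [(Finset.mem_filter.1 hp).2],
      Finset.sum_const, nsmul_eq_mul, repCount]
  rw [Finset.sum_congr rfl fun t _ => h t]
  refine (Finset.sum_fiberwise (A ×ˢ B ×ˢ C) (fun p => p.1 + p.2.1 * p.2.2)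
    fun p => ψ (p.1 + p.2.1 * p.2.2)).trans ?_
  rw [Finset.sum_product, Finset.sum_mul]
  refine Finset.sum_congr rfl fun a _ => ?_
  rw [Finset.sum_product, Finset.mul_sum]
  refine Finset.sum_congr rfl fun b _ => ?_
  rw [Finset.mul_sum]
  exact Finset.sum_congr rfl fun c _ => AddChar.map_add_eq_mul _ _ _

/-- The trivial character contributes the main term, all others together the error term. -/
theorem card_mul_sum_sq_repCount_le (A B C : Finset M) {k : ℝ}
    (hk : ∀ ψ : AddChar M ℂ, ψ ≠ 0 → (Nat.card ψ.rightKernel : ℝ) ≤ k) (hk0 : 0 ≤ k) :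
    (Fintype.card M : ℝ) * ∑ t, (repCount A B C t : ℝ) ^ 2
      ≤ (#A * #B * #C : ℝ) ^ 2 + #A * #B * #C * Fintype.card M ^ 2 * k := by
  classical
  have hpars := AddChar.sum_sq_norm_sum_mul (fun t : M => (repCount A B C t : ℂ))
  simp only [Complex.norm_natCast, sum_repCount_mul, norm_mul, mul_pow] at hpars
  rw [← hpars, ← Finset.add_sum_erase _ _ (Finset.mem_univ (0 : AddChar M ℂ))]
  refine add_le_add (le_of_eq ?_) ?_
  · simp
    ring
  calc ∑ ψ ∈ univ.erase (0 : AddChar M ℂ),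
        ‖∑ a ∈ A, ψ a‖ ^ 2 * ‖∑ b ∈ B, ∑ c ∈ C, ψ (b * c)‖ ^ 2
      ≤ ∑ ψ ∈ univ.erase (0 : AddChar M ℂ),
        ‖∑ a ∈ A, ψ a‖ ^ 2 * (#B * #C * Fintype.card M * k) := by
        refine Finset.sum_le_sum fun ψ hψ => ?_
        gcongr
        refine (sq_norm_sum_sum_addChar_mul_le ψ B C).trans ?_
        gcongr
        exact hk ψ (Finset.ne_of_mem_erase hψ)
    _ ≤ ∑ ψ : AddChar M ℂ, ‖∑ a ∈ A, ψ a‖ ^ 2 * (#B * #C * Fintype.card M * k) := by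
        refine Finset.sum_le_sum_of_subset_of_nonneg (Finset.subset_univ _) fun _ _ _ => ?_
        positivity
    _ = #A * #B * #C * Fintype.card M ^ 2 * k := by
        rw [← Finset.sum_mul, AddChar.sum_sq_norm_sum]
        ring

theorem sq_card_le_card_mul_sum_sq_repCount (A B C S : Finset M)
    (hS : ∀ a ∈ A, ∀ b ∈ B, ∀ c ∈ C, a + b * c ∈ S) :
    (#A * #B * #C : ℝ) ^ 2 ≤ #S * ∑ t, (repCount A B C t : ℝ) ^ 2 := by
  classical
  have hcard : (#A * #B * #C : ℝ) = ∑ t ∈ S, (repCount A B C t : ℝ) := by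
    have h : #(A ×ˢ B ×ˢ C) = ∑ t ∈ S, repCount A B C t := by
      rw [Finset.card_eq_sum_card_fiberwise (f := fun p => p.1 + p.2.1 * p.2.2) (t := S)]
      · refine Finset.sum_congr rfl fun t _ => ?_
        rw [repCount]
      · intro p hp
        simp only [Finset.coe_product, Set.mem_prod, Finset.mem_coe] at hp
        exact hS _ hp.1 _ hp.2.1 _ hp.2.2
    rw [Finset.card_product, Finset.card_product] at h
    rw [mul_assoc]
    exact_mod_cast h
  rw [hcard]
  refine sq_sum_le_card_mul_sum_sq.trans ?_
  gcongr
  exact Finset.subset_univ _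

/-- If all proper right ideals of `M` that arise as right kernels have index at least `Q`, and
`|A| |B| |C| ≥ c |M| ^ 3 / Q`, then every `S ⊇ A + B * C` has density at least `c / (1 + c)`. -/
theorem card_mul_le_of_mul_le (A B C S : Finset M) {Q c : ℝ} (hQ : 0 < Q) (hc : 0 < c)
    (hindex : ∀ ψ : AddChar M ℂ, ψ ≠ 0 → (Nat.card ψ.rightKernel : ℝ) * Q ≤ Fintype.card M)
    (hS : ∀ a ∈ A, ∀ b ∈ B, ∀ c ∈ C, a + b * c ∈ S)
    (h : c * ((Fintype.card M : ℝ) ^ 3 / Q) ≤ #A * #B * #C) :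
    c / (1 + c) * Fintype.card M ≤ #S := by
  set N : ℝ := (Fintype.card M : ℝ)
  set X : ℝ := #A * #B * #C
  have hN : 0 < N := by
    have := Fintype.card_pos (α := M)
    positivity
  have hX : 0 < X := lt_of_lt_of_le (by positivity) h
  have h1 : N * ∑ t, (repCount A B C t : ℝ) ^ 2 ≤ X ^ 2 + X * N ^ 2 * (N / Q) :=
    card_mul_sum_sq_repCount_le A B C (fun ψ hψ => (le_div_iff₀ hQ).2 (hindex ψ hψ))
      (by positivity)
  have h2 : X ^ 2 ≤ #S * ∑ t, (repCount A B C t : ℝ) ^ 2 :=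
    sq_card_le_card_mul_sum_sq_repCount A B C S hS
  have h3 : N ^ 2 * (N / Q) ≤ X / c := by
    rw [le_div_iff₀ hc]
    calc N ^ 2 * (N / Q) * c = c * (N ^ 3 / Q) := by ring
      _ ≤ X := h
  have h4 : X ^ 2 * N ≤ X ^ 2 * (#S * ((1 + c) / c)) := by
    calc X ^ 2 * N ≤ (#S * ∑ t, (repCount A B C t : ℝ) ^ 2) * N := by gcongr
      _ = #S * (N * ∑ t, (repCount A B C t : ℝ) ^ 2) := by ring
      _ ≤ #S * (X ^ 2 + X * (X / c)) := by
          gcongr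
          refine h1.trans ?_
          rw [mul_assoc]
          gcongr
      _ = X ^ 2 * (#S * ((1 + c) / c)) := by
          field_simp
          ring
  have h5 : N ≤ #S * ((1 + c) / c) := le_of_mul_le_mul_left h4 (by positivity)
  calc c / (1 + c) * N ≤ c / (1 + c) * (#S * ((1 + c) / c)) := by gcongr
    _ = #S := by field_simp

end FiniteRing

/-! ### Proper right ideals of a matrix ring over a local ring -/

theorem Matrix.card_residueField_pow_le_index {R : Type*} [CommRing R] [IsLocalRing R] [Finite R]
    {n : ℕ} (I : AddSubgroup (Matrix (Fin n) (Fin n) R)) (hmul : ∀ x ∈ I, ∀ c, x * c ∈ I)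
    (hI : (1 : Matrix (Fin n) (Fin n) R) ∉ I) :
    Nat.card (IsLocalRing.ResidueField R) ^ n ≤ I.index := by
  obtain ⟨i, hi⟩ : ∃ i, Matrix.single i i (1 : R) ∉ I := by
    by_contra! hall
    exact hI (Matrix.sum_single_one (m := Fin n) (α := R) ▸ I.sum_mem fun i _ => hall i)
  have hsurj := IsLocalRing.residue_surjective (R := R)
  let lift := Function.surjInv hsurj
  let row : (Fin n → IsLocalRing.ResidueField R) → Matrix (Fin n) (Fin n) R :=
    fun v => Matrix.of fun a j => if a = i then lift (v j) else 0
  have hinj : Function.Injective fun v => (row v : Matrix (Fin n) (Fin n) R ⧸ I) := by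
    intro v w hvw
    have hmem : -row v + row w ∈ I := QuotientAddGroup.eq.1 hvw
    funext j
    have hnu : ¬ IsUnit (-lift (v j) + lift (w j)) := by
      rintro ⟨u, hu⟩
      -- A unit in column `j` can be moved to column `i` and normalised, which gives `E_ii ∈ I`.
      apply hi
      convert hmul _ hmem (Matrix.single j i (↑u⁻¹ : R)) using 1
      ext a b
      by_cases hb : b = i
      · subst hb
        by_cases ha : a = b
        · subst ha
          simp [row, ← hu]
        · simp [row, ha, Ne.symm ha]
      · simp [Ne.symm hb, Matrix.mul_single_apply_of_ne _ _ _ _ _ hb]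
    have hz : IsLocalRing.residue R (-lift (v j) + lift (w j)) = 0 :=
      (IsLocalRing.residue_eq_zero_iff _).2 ((IsLocalRing.mem_maximalIdeal _).2 hnu)
    rw [map_add, map_neg, Function.surjInv_eq hsurj, Function.surjInv_eq hsurj] at hz
    exact neg_add_eq_zero.1 hz
  have := Nat.card_le_card_of_injective _ hinj
  rwa [Nat.card_fun, Nat.card_eq_fintype_card (α := Fin n), Fintype.card_fin] at this

theorem Matrix.card_rightKernel_mul_le {R : Type*} [CommRing R] [IsLocalRing R] [Finite R]
    {n : ℕ} {ψ : AddChar (Matrix (Fin n) (Fin n) R) ℂ} (hψ : ψ ≠ 0) :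
    Nat.card ψ.rightKernel * Nat.card (IsLocalRing.ResidueField R) ^ n
      ≤ Nat.card (Matrix (Fin n) (Fin n) R) := by
  rw [← ψ.rightKernel.card_mul_index]
  gcongr
  refine Matrix.card_residueField_pow_le_index _ (fun x hx c d => ?_) fun h1 => hψ ?_
  · rw [mul_assoc]
    exact hx _
  · exact AddChar.eq_zero_iff.2 fun x => by simpa using h1 x

/-! ### Expansion of `x + y * z` over finite chain rings -/

theorem Matrix.ncard_add_mul_ge {n : ℕ} (hn : 0 < n) {c : ℝ} (hc : 0 < c) {R : Type*}
    [CommRing R] [IsFiniteChainRing R] {q r : ℕ} (hqr : HasChainParameters R q r)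
    (A B C : Set (Matrix (Fin n) (Fin n) R))
    (h : c * (q : ℝ) ^ (3 * (r : ℝ) * (n : ℝ) ^ 2 - ((n : ℝ) + 1) / 2)
      ≤ (A.ncard : ℝ) * (B.ncard : ℝ) * (C.ncard : ℝ)) :
    c / (1 + c) * (q : ℝ) ^ (r * n ^ 2) ≤ ((A + B * C).ncard : ℝ) := by
  classical
  have : Fintype R := Fintype.ofFinite R
  have : Finite (IsLocalRing.ResidueField R) :=
    Finite.of_surjective _ IsLocalRing.residue_surjective
  have hq : 1 ≤ (q : ℝ) := by
    rw [← hqr.card_residueField]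
    exact_mod_cast Nat.card_pos
  have hq0 : 0 < (q : ℝ) := by linarith
  have hN : Nat.card (Matrix (Fin n) (Fin n) R) = q ^ (r * n ^ 2) := by
    rw [Nat.card_congr (Matrix.of (m := Fin n) (n := Fin n) (α := R)).symm, Nat.card_fun,
      Nat.card_fun, hqr.card_ring, Nat.card_eq_fintype_card, Fintype.card_fin]
    ring
  have hN' : (Fintype.card (Matrix (Fin n) (Fin n) R) : ℝ) = (q : ℝ) ^ (r * n ^ 2) := by
    rw [← Nat.card_eq_fintype_card, hN, Nat.cast_pow]
  have hn1 : (1 : ℝ) ≤ n := by exact_mod_cast hn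
  rw [← hN', Set.ncard_eq_toFinset_card' (A + B * C)]
  refine card_mul_le_of_mul_le A.toFinset B.toFinset C.toFinset _ (Q := (q : ℝ) ^ n)
    (by positivity) hc (fun ψ hψ => ?_) (fun a ha b hb c hc => ?_) ?_
  · rw [← hqr.card_residueField, ← Nat.card_eq_fintype_card]
    exact_mod_cast Matrix.card_rightKernel_mul_le hψ
  · rw [Set.mem_toFinset] at *
    exact Set.add_mem_add ha (Set.mul_mem_mul hb hc)
  · simp only [Set.ncard_eq_toFinset_card'] at h
    refine le_trans ?_ h
    gcongr
    rw [hN', ← pow_mul, ← Real.rpow_natCast, ← Real.rpow_natCast, ← Real.rpow_sub hq0]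
    refine Real.rpow_le_rpow_of_exponent_le hq ?_
    push_cast
    linarith

theorem mainTheorem4 (n : ℕ) (hn : 0 < n) :
    (∀ c : ℝ, 0 < c → ∃ c' : ℝ, 0 < c' ∧
      ∀ (R : Type u) [CommRing R] [IsFiniteChainRing R] (q r : ℕ), HasChainParameters R q r →
        ∀ A B C : Set (Matrix (Fin n) (Fin n) R),
          c * (q : ℝ) ^ (3 * (r : ℝ) * (n : ℝ) ^ 2 - ((n : ℝ) + 1) / 2) ≤
              (A.ncard : ℝ) * (B.ncard : ℝ) * (C.ncard : ℝ) →
            c' * (q : ℝ) ^ (r * n ^ 2) ≤ ((A + B * C).ncard : ℝ)) ∧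
    IsModerateExpander.{u} n 3 (fun _ _ v => v 0 + v 1 * v 2) (((n : ℝ) + 1) / 6) := by
  refine ⟨fun c hc => ⟨c / (1 + c), by positivity, fun R _ _ q r hqr A B C h =>
    Matrix.ncard_add_mul_ge hn hc hqr A B C h⟩, by positivity, 2, by norm_num, ?_⟩
  intro R _ _ q r hqr A h
  have himage : (fun v : Fin 3 → Matrix (Fin n) (Fin n) R => v 0 + v 1 * v 2) ''
      {v | ∀ i, v i ∈ A} = A + A * A := by
    ext t
    constructor
    · rintro ⟨v, hv, rfl⟩
      exact Set.add_mem_add (hv 0) (Set.mul_mem_mul (hv 1) (hv 2))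
    · rintro ⟨a, ha, _, ⟨b, hb, c, hc, rfl⟩, rfl⟩
      refine ⟨![a, b, c], fun i => ?_, by simp⟩
      fin_cases i <;> simpa
  rw [himage]
  -- Cubing the hypothesis gives the three-set hypothesis with constant `2 ^ 3 = 8`, hence
  -- density `8 / 9 ≥ 1 / 2`.
  have hcube : (8 : ℝ) * (q : ℝ) ^ (3 * (r : ℝ) * (n : ℝ) ^ 2 - ((n : ℝ) + 1) / 2)
      ≤ (A.ncard : ℝ) * (A.ncard : ℝ) * (A.ncard : ℝ) := by
    have h3 := pow_le_pow_left₀ (by positivity) h 3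
    rw [mul_pow, ← Real.rpow_mul_natCast (Nat.cast_nonneg q)] at h3
    calc _ = (2 : ℝ) ^ 3 *
          (q : ℝ) ^ (((r : ℝ) * (n : ℝ) ^ 2 - ((n : ℝ) + 1) / 6) * (3 : ℕ)) := by
          congr 1
          · norm_num
          · congr 1
            push_cast
            ring
      _ ≤ (A.ncard : ℝ) ^ 3 := h3
      _ = _ := by ring
  refine le_trans ?_ (Matrix.ncard_add_mul_ge hn (by norm_num) hqr A A A hcube)
  gcongr
  norm_num
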